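/- **Theorem (average age formula).** Let $\mathcal X$ be a finite alphabet, let $P$ be a pmf on $\mathcal X$, and let $X_1,X_2,\dots$ be i.i.d. with law $P$; the encoder observes $X_t$ at time $t$. For a binary codeword $w$ write $|w|$ for its length. The channel is noiseless and carries one bit per unit time. *Update scheme.* The encoder is free for the first time at time $1$. Whenever it is free at time $t$, it starts to transmit a codeword $w$; this codeword is completely received at time $t+|w|$, at which time the encoder is free again. For $t\ge 1$ let $U(t)$ be the largest time $u$ at which the encoder started to transmit the codeword of the source symbol $X_u$ and this codeword was completely received by time $t$; put $U(t)=0$ if there is no such $u$. The average age is $$\limsup_{T\to\infty}\frac1T\sum_{t=1}^T\bigl(t-U(t)\bigr).$$ (1) *Deterministic scheme.* Let $e:\mathcal X\to\{0,1\}^*$ be a prefix-free code, $\ell(x)=|e(x)|$, and $L=\ell(X)$ with $X\sim P$. Assume $\mathbb E L>0$ (this only excludes the empty codeword on a one-letter alphabet). When free at time $t$ the encoder transmits $e(X_t)$. Then the average age $\bar A(e)$ satisfies, almost surely, $$\bar A(e)=\mathbb E L+\frac{\mathbb E[L^2]}{2\,\mathbb E L}-\frac12 .$$ (2) *Randomized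 scheme.* Let $\emptyset$ be an additional symbol that is not in $\mathcal X$, let $e:\mathcal X\cup\{\emptyset\}\to\{0,1\}^*$ with $\ell(x)=|e(x)|$, and let $\theta:\mathcal X\to[0,1]$ with $\mathbb E\,\theta(X)>0$. Let $B_t$, $t\ge1$, be coin tosses with values in $\{0,1\}$ such that the pairs $(X_t,B_t)$, $t\ge 1$, are i.i.d. and $\Pr(X_t=x,\,B_t=1)=P(x)\theta(x)$ for all $x\in\mathcal X$. When free at time $t$ the encoder transmits $e(X_t)$ if $B_t=1$, and otherwise it skips $X_t$ and transmits $e(\emptyset)$ (which does not update $U$). Let $L(\theta)$ be the length of a transmitted codeword: it is $\ell(x)$ with probability $P(x)\theta(x)$ for $x\in\mathcal X$, and $\ell(\emptyset)$ with probability $1-\mathbb E\,\theta(X)$. Assume that $e$ is prefix-free on the set of the symbols of $\mathcal X\cup\{\emptyset\}$ that are transmitted with positive probability and that $\mathbb E L(\theta)>0$. Then the average age $\bar A(e,\theta)$ satisfies, almost surely, $$\bar A(e,\theta)=\frac{\mathbb E L(\theta)}{\mathbb E\,\theta(X)}+\frac{\mathbb E[L(\theta)^2]}{2\,\mathbb E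 L(\theta)}-\frac12 .$$ -/

import Mathlib

open MeasureTheory ProbabilityTheory Filter Topology

noncomputable section

namespace AgeOfInformation

/-- The binary code `e` is prefix-free on `S`: the codeword of a symbol of `S` is never a prefix
of the codeword of another symbol of `S`. -/
def IsPrefixFreeOn {α : Type*} (e : α → List Bool) (S : Set α) : Prop :=
  ∀ a ∈ S, ∀ b ∈ S, a ≠ b → ¬ e a <+: e b

/-- The expectation `E f(X)` for `X` distributed according to the pmf `P` on a finite set. -/
def expect {α : Type*} [Fintype α] (P : PMF α) (f : α → ℝ) : ℝ :=
  ∑ a, (P a).toReal * f a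

/-- Along a sample path, `c t` is the codeword which the encoder transmits if it is free at
time `t`. `pickupTime c k` is the time at which the encoder starts its `k`-th transmission
(counted from zero): the first one starts at time `1`, and the next one starts as soon as the
channel, which carries one bit per unit time, has carried all bits of the current codeword. -/
def pickupTime (c : ℕ → List Bool) : ℕ → ℕ
  | 0 => 1
  | k + 1 => pickupTime c k + (c (pickupTime c k)).length

/-- The time index `U(t)` at the receiver: the latest time `u ≤ t` at which the encoder started the
transmission of a source symbol (`isSource u`) all of whose bits have been received by time `t`;
the codeword whose transmission starts at time `u` is complete at the receiver at time
`u + length`. Before the first reception `U(t) = 0`. -/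
def receivedIndex (c : ℕ → List Bool) (isSource : ℕ → Prop) (t : ℕ) : ℕ :=
  sSup {u : ℕ | ∃ k, pickupTime c k = u ∧ isSource u ∧ u + (c u).length ≤ t}

/-- The time average `(1 / T) * ∑_{t = 1}^T (t - U(t))` of the age up to time `T`. -/
def timeAverageAge (c : ℕ → List Bool) (isSource : ℕ → Prop) (T : ℕ) : ℝ :=
  (1 / (T : ℝ)) * ∑ t ∈ Finset.Icc 1 T, ((t : ℝ) - (receivedIndex c isSource t : ℝ))

/-- The average age of a sample path, a limit superior (taken in the extended reals). -/
def averageAge (c : ℕ → List Bool) (isSource : ℕ → Prop) : EReal :=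
  limsup (fun T : ℕ => ((timeAverageAge c isSource T : ℝ) : EReal)) atTop

/-- The average age of the memoryless update scheme with code `e`, for the source path `x`. -/
def memorylessAverageAge {𝒳 : Type*} (e : 𝒳 → List Bool) (x : ℕ → 𝒳) : EReal :=
  averageAge (fun t => e (x t)) (fun _ => True)

/-- The average age of the randomized memoryless update scheme, for the source path `x` and the
coin tosses `b`: when the encoder is free at time `t`, it transmits `x t` if `b t = true`, and
otherwise skips `x t` and transmits the special symbol `∅`, here `none`. -/
def randomizedAverageAge {𝒳 : Type*} (e : Option 𝒳 → List Bool) (x : ℕ → 𝒳) (b : ℕ → Bool) :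
    EReal :=
  averageAge (fun t => if b t = true then e (some (x t)) else e none) (fun t => b t = true)

lemma sum_mul_ofReal_le_one {𝒳 : Type*} [Fintype 𝒳] (P : PMF 𝒳) (θ : 𝒳 → Set.Icc (0 : ℝ) 1) :
    ∑ x, P x * ENNReal.ofReal (θ x) ≤ 1 := by
  calc ∑ x, P x * ENNReal.ofReal (θ x) ≤ ∑ x, P x := by
        refine Finset.sum_le_sum fun x _ => ?_
        calc P x * ENNReal.ofReal (θ x) ≤ P x * 1 := by
              gcongr
              exact ENNReal.ofReal_le_one.2 (θ x).2.2
          _ = P x := mul_one _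
    _ = 1 := by rw [← tsum_fintype (L := .unconditional _)]; exact P.tsum_coe

/-- The law of the symbol transmitted by the randomized scheme: `x` with probability `P(x) θ(x)`,
and `∅` with probability `1 - E θ(X)`. The length of its codeword is `L(θ)`. -/
def sentPMF {𝒳 : Type*} [Fintype 𝒳] (P : PMF 𝒳) (θ : 𝒳 → Set.Icc (0 : ℝ) 1) : PMF (Option 𝒳) :=
  PMF.ofFintype
    (fun o => o.elim (1 - ∑ x, P x * ENNReal.ofReal (θ x)) (fun x => P x * ENNReal.ofReal (θ x)))
    (by
      rw [Fintype.sum_option]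
      exact tsub_add_cancel_of_le (sum_mul_ofReal_le_one P θ))

end AgeOfInformation

end

/-! Let l_k be the length of the k-th transmitted codeword and D_k the age when its transmission
starts. The received index is constant during a transmission, so the ages there are D_k, D_k + 1,
... and sum to D_k l_k + (l_k² - l_k)/2 (`sum_age_pickupTime`). Hence the average age is (b + (m₂ -
m₁)/2)/m₁, where m₁, m₂, b are the limiting averages of l_k, l_k², D_k l_k
(`averageAge_eq_of_tendsto`).

The sent symbols are i.i.d.: once the earlier ones are prescribed, the next is read at a
deterministic, fresh time (`measure_forall_sentSymbol_eq`). So l_k is independent of D_k, a function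
of the past, and b = m₁ d with d the limiting average of D_k. Let s_k indicate a source symbol, with
mean p. Summing D_{k+1} = l_k + (1 - s_k) D_k (`sum_ite_ageAtPickup`) gives p d = m₁, and the
formula follows; the deterministic scheme has p = 1.

Almost sure convergence comes from a strong law for orthogonal sequences
(`ae_tendsto_average_of_orthogonal`), applied to centred functions of the k-th symbol weighted by 1
or D_k. Since D_k need not be bounded, its second moments are controlled by
`exists_integral_sq_ageAtPickup_le`. -/

noncomputable section

namespace AgeOfInformation

/-! ### A strong law for orthogonal sequences -/

section LawOfLargeNumbers

variable {Ω : Type*} [MeasurableSpace Ω] {μ : Measure Ω}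

/-- A sequence whose second moments are summable tends to zero almost surely. -/
lemma ae_tendsto_zero_of_integral_sq_le {f : ℕ → Ω → ℝ} (hf : ∀ n, MemLp (f n) 2 μ)
    {a : ℕ → ℝ} (ha : Summable a) (hfa : ∀ n, ∫ ω, f n ω ^ 2 ∂μ ≤ a n) :
    ∀ᵐ ω ∂μ, Tendsto (fun n => f n ω) atTop (𝓝 0) := by
  have hint : ∀ n, Integrable (fun ω => f n ω ^ 2) μ := fun n => (hf n).integrable_sq
  have hmeas : ∀ n, AEMeasurable (fun ω => ENNReal.ofReal (f n ω ^ 2)) μ :=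
    fun n => (hint n).aemeasurable.ennreal_ofReal
  have hsum : ∫⁻ ω, ∑' n, ENNReal.ofReal (f n ω ^ 2) ∂μ ≠ ⊤ := by
    rw [lintegral_tsum hmeas]
    refine ne_top_of_le_ne_top ha.tsum_ofReal_ne_top (ENNReal.tsum_le_tsum fun n => ?_)
    rw [← ofReal_integral_eq_lintegral_ofReal (hint n) (ae_of_all _ fun ω => sq_nonneg _)]
    exact ENNReal.ofReal_le_ofReal (hfa n)
  filter_upwards [ae_lt_top' (AEMeasurable.tsum hmeas) hsum] with ω hω
  have h0 := ENNReal.tendsto_atTop_zero_of_tsum_ne_top hω.ne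
  have h1 : Tendsto (fun n => f n ω ^ 2) atTop (𝓝 0) := by
    have := (ENNReal.tendsto_toReal ENNReal.zero_ne_top).comp h0
    simpa [Function.comp_def, ENNReal.toReal_ofReal, sq_nonneg] using this
  have h2 := h1.sqrt
  simp only [Real.sqrt_sq_eq_abs, Real.sqrt_zero] at h2
  exact (tendsto_zero_iff_abs_tendsto_zero _).2 h2

lemma integral_sq_sum_le_of_orthogonal {X : ℕ → Ω → ℝ} (hX : ∀ k, MemLp (X k) 2 μ) {C : ℝ}
    (hC : ∀ k, ∫ ω, X k ω ^ 2 ∂μ ≤ C) (horth : ∀ j k, j < k → ∫ ω, X j ω * X k ω ∂μ = 0) (n : ℕ) :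
    ∫ ω, (∑ k ∈ Finset.range n, X k ω) ^ 2 ∂μ ≤ n * C := by
  have hS : ∀ n, MemLp (fun ω => ∑ k ∈ Finset.range n, X k ω) 2 μ :=
    fun n => memLp_finsetSum _ fun k _ => hX k
  induction n with
  | zero => simp
  | succ n ih =>
    have h : ∀ ω, (∑ k ∈ Finset.range (n + 1), X k ω) ^ 2 =
        (∑ k ∈ Finset.range n, X k ω) ^ 2 + 2 * (∑ k ∈ Finset.range n, X k ω * X n ω)
          + X n ω ^ 2 := by
      intro ω
      rw [Finset.sum_range_succ, ← Finset.sum_mul]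
      ring
    have hmul : ∀ k, Integrable (fun ω => X k ω * X n ω) μ :=
      fun k => (hX k).integrable_mul (hX n)
    simp only [h]
    rw [integral_add _ (hX n).integrable_sq, integral_add (hS n).integrable_sq,
      integral_const_mul, integral_finsetSum _ fun k _ => hmul k,
      Finset.sum_eq_zero fun k hk => horth k n (Finset.mem_range.1 hk)]
    · push_cast
      linarith [hC n]
    · exact (integrable_finsetSum _ fun k _ => hmul k).const_mul 2
    · exact (hS n).integrable_sq.add ((integrable_finsetSum _ fun k _ => hmul k).const_mul 2)

/-- Strong law of large numbers for orthogonal sequences that are bounded in `L²`. -/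
theorem ae_tendsto_average_of_orthogonal {X : ℕ → Ω → ℝ} (hX : ∀ k, MemLp (X k) 2 μ) {C : ℝ}
    (hC : ∀ k, ∫ ω, X k ω ^ 2 ∂μ ≤ C) (horth : ∀ j k, j < k → ∫ ω, X j ω * X k ω ∂μ = 0) :
    ∀ᵐ ω ∂μ, Tendsto (fun n : ℕ => (∑ k ∈ Finset.range n, X k ω) / n) atTop (𝓝 0) := by
  have hC0 : 0 ≤ C := (integral_nonneg fun ω => sq_nonneg _).trans (hC 0)
  have hsummable : ∀ K : ℝ, Summable fun n : ℕ => K * (1 / (n : ℝ) ^ 2) := fun K =>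
    (Real.summable_one_div_nat_pow.2 one_lt_two).mul_left K
  -- Averages along the squares, and the largest possible drift between consecutive squares: both
  -- have second moments of order 1/n².
  let S : ℕ → Ω → ℝ := fun n ω => (∑ k ∈ Finset.range (n ^ 2), X k ω) / (n : ℝ) ^ 2
  let G : ℕ → Ω → ℝ := fun n ω =>
    (∑ k ∈ Finset.Ico (n ^ 2) ((n + 1) ^ 2), |X k ω|) / (n : ℝ) ^ 2
  have hS : ∀ᵐ ω ∂μ, Tendsto (fun n => S n ω) atTop (𝓝 0) := by
    refine ae_tendsto_zero_of_integral_sq_le (fun n => ?_) (hsummable C) fun n => ?_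
    · simpa only [S, div_eq_mul_inv] using
        (memLp_finsetSum _ fun k _ => hX k).mul_const (((n : ℝ) ^ 2)⁻¹)
    · simp only [S, div_pow]
      rw [integral_div]
      -- At n = 0 both sides vanish, since division by zero gives zero.
      rcases Nat.eq_zero_or_pos n with rfl | hn
      · simp
      have hn' : (0 : ℝ) < n := by exact_mod_cast hn
      have := integral_sq_sum_le_of_orthogonal hX hC horth (n ^ 2)
      push_cast at this
      rw [div_le_iff₀ (by positivity)]
      refine this.trans (le_of_eq ?_)
      field_simp
  have hG : ∀ᵐ ω ∂μ, Tendsto (fun n => G n ω) atTop (𝓝 0) := by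
    -- Cauchy–Schwarz on 2n + 1 terms bounds the second moment by (2n + 1)² C / n⁴; the 9 comes from
    -- 2n + 1 ≤ 3n.
    refine ae_tendsto_zero_of_integral_sq_le (fun n => ?_) (hsummable (9 * C)) fun n => ?_
    · have habs : MemLp (fun ω => ∑ k ∈ Finset.Ico (n ^ 2) ((n + 1) ^ 2), |X k ω|) 2 μ :=
        memLp_finsetSum _ fun k _ => (hX k).abs
      simpa only [G, div_eq_mul_inv] using habs.mul_const (((n : ℝ) ^ 2)⁻¹)
    · simp only [G, div_pow]
      rw [integral_div]
      rcases Nat.eq_zero_or_pos n with rfl | hn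
      · simp
      have hn' : (1 : ℝ) ≤ n := by exact_mod_cast hn
      have hcard : ((Finset.Ico (n ^ 2) ((n + 1) ^ 2)).card : ℝ) = 2 * n + 1 := by
        rw [Nat.card_Ico, Nat.cast_sub (by gcongr; omega)]
        push_cast
        ring
      have h1 : ∫ ω, (∑ k ∈ Finset.Ico (n ^ 2) ((n + 1) ^ 2), |X k ω|) ^ 2 ∂μ ≤
          ∫ ω, (2 * n + 1) * ∑ k ∈ Finset.Ico (n ^ 2) ((n + 1) ^ 2), X k ω ^ 2 ∂μ := by
        refine integral_mono (memLp_finsetSum _ fun k _ => (hX k).abs).integrable_sq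
          ((integrable_finsetSum _ fun k _ => (hX k).integrable_sq).const_mul _) fun ω => ?_
        have := sq_sum_le_card_mul_sum_sq (s := Finset.Ico (n ^ 2) ((n + 1) ^ 2))
          (f := fun k => |X k ω|)
        simpa only [hcard, sq_abs] using this
      have h2 : ∫ ω, (2 * n + 1) * ∑ k ∈ Finset.Ico (n ^ 2) ((n + 1) ^ 2), X k ω ^ 2 ∂μ ≤
          (2 * n + 1) * ((2 * n + 1) * C) := by
        rw [integral_const_mul, integral_finsetSum _ fun k _ => (hX k).integrable_sq]
        gcongr
        refine (Finset.sum_le_sum fun k _ => hC k).trans (le_of_eq ?_)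
        rw [Finset.sum_const, nsmul_eq_mul, hcard]
      rw [div_le_iff₀ (by positivity)]
      refine (h1.trans h2).trans ?_
      have h3 : 9 * C * (1 / (n : ℝ) ^ 2) * ((n : ℝ) ^ 2) ^ 2 = 3 * n * (3 * n * C) := by
        field_simp
        ring
      rw [h3]
      gcongr <;> linarith
  have hsqrt : Tendsto Nat.sqrt atTop atTop :=
    tendsto_atTop.2 fun b => (eventually_ge_atTop (b ^ 2)).mono fun n hn => Nat.le_sqrt'.2 hn
  filter_upwards [hS, hG] with ω hSω hGω
  have hlim := (hSω.abs.add hGω).comp hsqrt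
  rw [abs_zero, add_zero] at hlim
  refine squeeze_zero_norm' ?_ hlim
  filter_upwards [eventually_ge_atTop 1] with m hm
  set n := Nat.sqrt m with hn
  have hn1 : 1 ≤ n := Nat.le_sqrt'.2 (by simpa using hm)
  have hnm : n ^ 2 ≤ m := Nat.sqrt_le' m
  have hmn : m ≤ (n + 1) ^ 2 := (Nat.lt_succ_sqrt' m).le
  have hnpos : (0 : ℝ) < (n : ℝ) ^ 2 := by positivity
  have hnm' : (n : ℝ) ^ 2 ≤ m := by exact_mod_cast hnm
  simp only [Function.comp_apply, ← hn, S, G, Real.norm_eq_abs, abs_div, Nat.abs_cast, abs_pow]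
  rw [← add_div]
  have hnum : |∑ k ∈ Finset.range m, X k ω| ≤ |∑ k ∈ Finset.range (n ^ 2), X k ω| +
      ∑ k ∈ Finset.Ico (n ^ 2) ((n + 1) ^ 2), |X k ω| := by
    rw [← Finset.sum_range_add_sum_Ico _ hnm]
    refine (abs_add_le _ _).trans ?_
    gcongr
    refine (Finset.abs_sum_le_sum_abs _ _).trans ?_
    exact Finset.sum_le_sum_of_subset_of_nonneg (Finset.Ico_subset_Ico_right hmn)
      fun _ _ _ => abs_nonneg _
  exact (div_le_div_of_nonneg_left (abs_nonneg _) hnpos hnm').trans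
    (div_le_div_of_nonneg_right hnum hnpos.le)

end LawOfLargeNumbers

/-! ### Ages along a fixed sample path -/

section SamplePath

variable (c : ℕ → List Bool) (isSource : ℕ → Prop)

/-- The time at which the last source symbol among the first `k` transmissions was picked up. -/
def lastSource : ℕ → ℕ
  | 0 => 0
  | k + 1 => open Classical in if isSource (pickupTime c k) then pickupTime c k else lastSource k

/-- The age at the start of the `k`-th transmission. -/
def ageAtPickup (k : ℕ) : ℝ := (pickupTime c k : ℝ) - (lastSource c isSource k : ℝ)

/-- The length of the `k`-th transmitted codeword. -/
def sentLength (k : ℕ) : ℕ := (c (pickupTime c k)).length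

lemma pickupTime_succ (k : ℕ) : pickupTime c (k + 1) = pickupTime c k + sentLength c k := rfl

lemma pickupTime_eq (k : ℕ) : pickupTime c k = 1 + ∑ j ∈ Finset.range k, sentLength c j := by
  induction k with
  | zero => rfl
  | succ k ih => rw [Finset.sum_range_succ, pickupTime_succ, ih, add_assoc]

lemma one_le_pickupTime (k : ℕ) : 1 ≤ pickupTime c k := by
  rw [pickupTime_eq]
  exact Nat.le_add_right _ _

lemma ageAtPickup_zero : ageAtPickup c isSource 0 = 1 := by
  simp [ageAtPickup, pickupTime, lastSource]

-- A source symbol has age equal to its codeword length when its transmission ends; otherwise the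
-- old age grows by that length.
open Classical in
lemma ageAtPickup_succ (k : ℕ) : ageAtPickup c isSource (k + 1) =
    sentLength c k + if isSource (pickupTime c k) then 0 else ageAtPickup c isSource k := by
  unfold ageAtPickup
  rw [pickupTime_succ, lastSource]
  split_ifs <;> push_cast <;> ring

variable {c}

lemma strictMono_pickupTime (hpos : ∀ k, 0 < sentLength c k) : StrictMono (pickupTime c) :=
  strictMono_nat_of_lt_succ fun k => by
    rw [pickupTime_succ]
    exact Nat.lt_add_of_pos_right (hpos k)

/-- Transmission j is complete by time t iff `pickupTime c (j + 1) ≤ t`. Positive lengths make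
pickup times strictly increasing, so during transmission k this means j < k. -/
lemma receivedIndex_eq_lastSource (hpos : ∀ k, 0 < sentLength c k) {k t : ℕ}
    (hkt : pickupTime c k ≤ t) (htk : t < pickupTime c (k + 1)) :
    receivedIndex c isSource t = lastSource c isSource k := by
  have hmono := strictMono_pickupTime hpos
  have hset : {u : ℕ | ∃ k, pickupTime c k = u ∧ isSource u ∧ u + (c u).length ≤ t} =
      {u : ℕ | ∃ j < k, pickupTime c j = u ∧ isSource u} := by
    ext u
    constructor
    · rintro ⟨j, rfl, hs, hj⟩
      exact ⟨j, Nat.lt_of_succ_lt_succ (hmono.lt_iff_lt.1 (lt_of_le_of_lt hj htk)), rfl, hs⟩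
    · rintro ⟨j, hj, rfl, hs⟩
      exact ⟨j, rfl, hs, (hmono.monotone (Nat.succ_le_of_lt hj)).trans hkt⟩
  rw [receivedIndex, hset]
  clear hset hkt htk
  induction k with
  -- The supremum of the empty set in `ℕ` is 0, matching the value of U before the first reception.
  | zero => simp [lastSource]
  | succ k ih =>
    rw [lastSource]
    split_ifs with hs
    · refine IsGreatest.csSup_eq ⟨⟨k, Nat.lt_succ_self k, rfl, hs⟩, ?_⟩
      rintro u ⟨j, hj, rfl, -⟩
      exact hmono.monotone (Nat.le_of_lt_succ hj)
    · rw [← ih]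
      congr 1
      ext u
      constructor
      · rintro ⟨j, hj, rfl, hj'⟩
        refine ⟨j, lt_of_le_of_ne (Nat.le_of_lt_succ hj) ?_, rfl, hj'⟩
        rintro rfl
        exact hs hj'
      · rintro ⟨j, hj, h⟩
        exact ⟨j, hj.trans (Nat.lt_succ_self k), h⟩

lemma receivedIndex_le (t : ℕ) : receivedIndex c isSource t ≤ t := by
  rcases Set.eq_empty_or_nonempty
    {u : ℕ | ∃ k, pickupTime c k = u ∧ isSource u ∧ u + (c u).length ≤ t} with h | h
  · rw [receivedIndex, h]
    simp
  · refine csSup_le h ?_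
    rintro u ⟨k, -, -, hu⟩
    omega

/-- The sum of the ages during the first `n` transmissions. -/
lemma sum_age_pickupTime (hpos : ∀ k, 0 < sentLength c k) (n : ℕ) :
    ∑ t ∈ Finset.Icc 1 (pickupTime c n - 1), ((t : ℝ) - (receivedIndex c isSource t : ℝ)) =
      ∑ k ∈ Finset.range n, (ageAtPickup c isSource k * sentLength c k
        + ((sentLength c k : ℝ) ^ 2 - sentLength c k) / 2) := by
  have hIcc : ∀ n, Finset.Icc 1 (pickupTime c n - 1) = Finset.Ico 1 (pickupTime c n) := by
    intro n
    ext t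
    have := one_le_pickupTime c n
    simp only [Finset.mem_Icc, Finset.mem_Ico]
    omega
  simp only [hIcc]
  induction n with
  | zero => simp [pickupTime]
  | succ n ih =>
    rw [Finset.sum_range_succ, ← ih, ← Finset.sum_Ico_consecutive _ (one_le_pickupTime c n)
      (strictMono_pickupTime hpos (Nat.lt_succ_self n)).le]
    congr 1
    have h : ∀ t ∈ Finset.Ico (pickupTime c n) (pickupTime c (n + 1)),
        (t : ℝ) - (receivedIndex c isSource t : ℝ) = (t : ℝ) - lastSource c isSource n := by
      intro t ht
      rw [Finset.mem_Ico] at ht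
      rw [receivedIndex_eq_lastSource isSource hpos ht.1 ht.2]
    rw [Finset.sum_congr rfl h, Finset.sum_Ico_eq_sum_range, pickupTime_succ,
      Nat.add_sub_cancel_left]
    have hgauss : ∀ m : ℕ, ∑ i ∈ Finset.range m,
        (((pickupTime c n + i : ℕ) : ℝ) - lastSource c isSource n) =
        ageAtPickup c isSource n * m + ((m : ℝ) ^ 2 - m) / 2 := by
      intro m
      induction m with
      | zero => simp
      | succ m ihm =>
        rw [Finset.sum_range_succ, ihm, ageAtPickup]
        push_cast
        ring
    exact hgauss _

/-- The average age of a path is determined by the averages over its transmissions. -/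
theorem averageAge_eq_of_tendsto (hpos : ∀ k, 0 < sentLength c k) {M : ℕ}
    (hM : ∀ k, sentLength c k ≤ M) {m₁ m₂ b : ℝ} (hm₁ : 0 < m₁)
    (h₁ : Tendsto (fun n : ℕ => (∑ k ∈ Finset.range n, (sentLength c k : ℝ)) / n) atTop (𝓝 m₁))
    (h₂ : Tendsto (fun n : ℕ => (∑ k ∈ Finset.range n, (sentLength c k : ℝ) ^ 2) / n) atTop
      (𝓝 m₂))
    (hb : Tendsto (fun n : ℕ =>
      (∑ k ∈ Finset.range n, ageAtPickup c isSource k * sentLength c k) / n) atTop (𝓝 b)) :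
    averageAge c isSource = (((b + (m₂ - m₁) / 2) / m₁ : ℝ) : EReal) := by
  set u : ℕ → ℝ := fun T =>
    ∑ t ∈ Finset.Icc 1 T, ((t : ℝ) - (receivedIndex c isSource t : ℝ)) with hu
  have hmono : Monotone u := fun T T' hT =>
    Finset.sum_le_sum_of_subset_of_nonneg (Finset.Icc_subset_Icc_right hT) fun t _ _ =>
      sub_nonneg.2 (by exact_mod_cast receivedIndex_le isSource t)
  have hc : ∀ n, pickupTime c n - 1 = ∑ k ∈ Finset.range n, sentLength c k := by
    intro n
    rw [pickupTime_eq, Nat.add_sub_cancel_left]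
  have hctop : Tendsto (fun n => pickupTime c n - 1) atTop atTop := by
    refine tendsto_atTop_mono (fun n => ?_) tendsto_id
    rw [hc]
    simpa using Finset.sum_le_sum fun k (_ : k ∈ Finset.range n) => Nat.succ_le_of_lt (hpos k)
  have hlim : Tendsto (fun n => u (pickupTime c n - 1) / ((pickupTime c n - 1 : ℕ) : ℝ)) atTop
      (𝓝 ((b + (m₂ - m₁) / 2) / m₁)) := by
    refine ((hb.add ((h₂.sub h₁).div_const 2)).div h₁ hm₁.ne').congr' ?_
    filter_upwards [eventually_gt_atTop 0] with n hn
    have hn' : (n : ℝ) ≠ 0 := by exact_mod_cast hn.ne'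
    rw [hu]
    beta_reduce
    rw [sum_age_pickupTime isSource hpos, hc, Finset.sum_add_distrib, ← Finset.sum_div,
      Finset.sum_sub_distrib, Nat.cast_sum]
    simp only [Pi.div_apply]
    rw [← sub_div, div_right_comm _ (n : ℝ) 2, ← add_div, div_div_div_cancel_right₀ hn']
  -- The age sum is monotone in T, so convergence along the ends of transmissions suffices if
  -- consecutive ends eventually have ratio at most a, for every a > 1. Bounded lengths ensure this.
  have havg := tendsto_div_of_monotone_of_exists_subseq_tendsto_div u _ hmono fun a ha =>
    ⟨fun n => pickupTime c n - 1, by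
      have hreal : Tendsto (fun n => (a - 1) * ((pickupTime c n - 1 : ℕ) : ℝ)) atTop atTop :=
        (tendsto_natCast_atTop_atTop.comp hctop).const_mul_atTop (sub_pos.2 ha)
      filter_upwards [hreal.eventually_ge_atTop (M : ℝ)] with n hn
      have h : ((pickupTime c (n + 1) - 1 : ℕ) : ℝ) =
          ((pickupTime c n - 1 : ℕ) : ℝ) + sentLength c n := by
        rw [hc, hc, Finset.sum_range_succ]
        push_cast
        ring
      have hMn : (sentLength c n : ℝ) ≤ M := by exact_mod_cast hM n
      rw [h]
      linarith, hctop, hlim⟩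
  refine Tendsto.limsup_eq (EReal.tendsto_coe.2 (havg.congr fun T => ?_))
  rw [timeAverageAge, one_div, inv_mul_eq_div]

open Classical in
/-- The age at the pickups grows by the lengths and is reset by the source symbols. -/
lemma sum_ite_ageAtPickup (n : ℕ) :
    ∑ k ∈ Finset.range n,
      (if isSource (pickupTime c k) then (1 : ℝ) else 0) * ageAtPickup c isSource k =
      ∑ k ∈ Finset.range n, (sentLength c k : ℝ) - ageAtPickup c isSource n + 1 := by
  induction n with
  | zero => simp [ageAtPickup_zero]
  | succ n ih =>
    rw [Finset.sum_range_succ, Finset.sum_range_succ, ih, ageAtPickup_succ]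
    split_ifs <;> ring

end SamplePath

/-! ### The sent symbols are i.i.d. -/

section SentSymbols

variable {𝒴 : Type*} {Ω : Type*}

/-- The symbol whose codeword is sent by the `k`-th transmission. -/
def sentSymbol (code : 𝒴 → List Bool) (Y : ℕ → Ω → 𝒴) (k : ℕ) (ω : Ω) : 𝒴 :=
  Y (pickupTime (fun t => code (Y t ω)) k) ω

/-- The symbols sent by the transmissions before the `k`-th one. -/
def sentPast (code : 𝒴 → List Bool) (Y : ℕ → Ω → 𝒴) (k : ℕ) (ω : Ω) (i : Fin k) : 𝒴 :=
  sentSymbol code Y i ω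

variable {code : 𝒴 → List Bool} {Y : ℕ → Ω → 𝒴}

lemma sentLength_eq (k : ℕ) (ω : Ω) :
    sentLength (fun t => code (Y t ω)) k = (code (sentSymbol code Y k ω)).length := rfl

/-- The first symbols sent are those read at the deterministic times given by their lengths. -/
lemma forall_sentSymbol_eq_iff (w : ℕ → 𝒴) (ω : Ω) (n : ℕ) :
    (∀ i < n, sentSymbol code Y i ω = w i) ↔
      ∀ i < n, Y (∑ j ∈ Finset.range i, (code (w j)).length + 1) ω = w i := by
  induction n with
  | zero => simp
  | succ n ih =>
    rw [Nat.forall_lt_succ_right, Nat.forall_lt_succ_right, ← ih]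
    refine and_congr_right fun h => ?_
    rw [sentSymbol, pickupTime_eq, add_comm 1, Finset.sum_congr rfl fun j hj => ?_]
    rw [sentLength_eq, h j (Finset.mem_range.1 hj)]

variable [MeasurableSpace 𝒴] [MeasurableSingletonClass 𝒴]
  [MeasurableSpace Ω] {μ : Measure Ω} {ν : Measure 𝒴}

lemma memLp_comp_of_finite [Finite 𝒴] [IsFiniteMeasure μ] {p : ENNReal} {Z : Ω → 𝒴} (hZ : Measurable Z) (F : 𝒴 → ℝ) :
    MemLp (fun ω => F (Z ω)) p μ := by
  obtain ⟨C, hC⟩ := (Set.finite_range fun y => ‖F y‖).bddAbove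
  exact MemLp.of_bound ((measurable_of_finite F).comp hZ).aestronglyMeasurable C
    (ae_of_all _ fun ω => hC ⟨Z ω, rfl⟩)

lemma measurable_sentSymbol [Finite 𝒴] (hY : ∀ t, 1 ≤ t → Measurable (Y t))
    (k : ℕ) : Measurable (sentSymbol code Y k) := by
  -- The shift by one avoids `Y 0`, about which nothing is assumed.
  have hread : ∀ T : Ω → ℕ, (∀ ω, 1 ≤ T ω) → Measurable T → Measurable fun ω => Y (T ω) ω := by
    intro T hT1 hT
    have h : Measurable fun q : ℕ × Ω => Y (q.1 + 1) q.2 :=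
      measurable_from_prod_countable_right fun t => hY (t + 1) (Nat.le_add_left _ _)
    have h2 : Measurable fun ω => (T ω - 1, ω) := (hT.sub_const 1).prodMk measurable_id
    convert h.comp h2 using 2 with ω
    simp [Nat.sub_add_cancel (hT1 ω)]
  have hT : Measurable fun ω => pickupTime (fun t => code (Y t ω)) k := by
    induction k with
    | zero => exact measurable_const
    | succ k ih =>
      exact ih.add ((measurable_of_finite fun y => (code y).length).comp
        (hread _ (fun ω => one_le_pickupTime _ k) ih))
  exact hread _ (fun ω => one_le_pickupTime _ k) hT

lemma measurable_sentPast [Finite 𝒴] (hY : ∀ t, 1 ≤ t → Measurable (Y t))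
    (k : ℕ) : Measurable (sentPast code Y k) :=
  measurable_pi_lambda _ fun i => measurable_sentSymbol hY i

/-- The event says that Y takes prescribed values at deterministic times. If all values have
positive mass, their lengths are positive, the times are distinct and independence applies;
otherwise both sides are zero. -/
lemma measure_forall_sentSymbol_eq (hY : ∀ t, 1 ≤ t → Measurable (Y t))
    (hindep : iIndepFun (fun t => Y (t + 1)) μ) (hlaw : ∀ t, 1 ≤ t → μ.map (Y t) = ν)
    (hpos : ∀ y, ν {y} ≠ 0 → 0 < (code y).length) (w : ℕ → 𝒴) (n : ℕ) :
    μ {ω | ∀ i < n, sentSymbol code Y i ω = w i} = ∏ i ∈ Finset.range n, ν {w i} := by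
  set τ : ℕ → ℕ := fun i => ∑ j ∈ Finset.range i, (code (w j)).length with hτ
  have hmarg : ∀ i, μ (Y (τ i + 1) ⁻¹' {w i}) = ν {w i} := fun i => by
    rw [← hlaw (τ i + 1) (Nat.le_add_left _ _),
      Measure.map_apply (hY _ (Nat.le_add_left _ _)) (measurableSet_singleton _)]
  have hset : {ω | ∀ i < n, sentSymbol code Y i ω = w i} =
      ⋂ i ∈ (Finset.univ : Finset (Fin n)), Y (τ i + 1) ⁻¹' {w i} := by
    ext ω
    simp only [Set.mem_ofPred_eq, forall_sentSymbol_eq_iff, Finset.mem_univ, Set.iInter_true,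
      Set.mem_iInter, Set.mem_preimage, Set.mem_singleton_iff, Fin.forall_iff, hτ]
  rw [hset]
  by_cases h : ∀ i < n, ν {w i} ≠ 0
  · have hinj : Function.Injective fun i : Fin n => τ i := by
      refine StrictMono.injective fun i j hij => ?_
      have h1 : τ (i + 1) ≤ τ j := Finset.sum_le_sum_of_subset
        (Finset.range_mono (Nat.succ_le_of_lt (Fin.lt_def.1 hij)))
      have h2 : τ (i + 1) = τ i + (code (w i)).length := Finset.sum_range_succ _ _
      have h3 := hpos _ (h i i.2)
      change τ i < τ j
      omega
    rw [(hindep.precomp hinj).measure_inter_preimage_eq_mul Finset.univ (sets := fun i => {w i})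
      fun i _ => measurableSet_singleton _, Finset.prod_range]
    exact Finset.prod_congr rfl fun i _ => hmarg i
  · push Not at h
    obtain ⟨i, hi, hi0⟩ := h
    rw [Finset.prod_eq_zero (Finset.mem_range.2 hi) hi0]
    exact measure_mono_null (Set.biInter_subset_of_mem (Finset.mem_univ (⟨i, hi⟩ : Fin n)))
      ((hmarg i).trans hi0)

variable [Finite 𝒴] [IsProbabilityMeasure ν]

/-- A sent symbol is independent of the previous ones and has the law of the source. -/
lemma map_sentSymbol_prod (hY : ∀ t, 1 ≤ t → Measurable (Y t))
    (hindep : iIndepFun (fun t => Y (t + 1)) μ) (hlaw : ∀ t, 1 ≤ t → μ.map (Y t) = ν)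
    (hpos : ∀ y, ν {y} ≠ 0 → 0 < (code y).length) (k : ℕ) :
    μ.map (fun ω => (sentPast code Y k ω, sentSymbol code Y k ω)) =
      (Measure.pi fun _ : Fin k => ν).prod ν := by
  refine Measure.ext_of_singleton fun q => ?_
  obtain ⟨w, v⟩ := q
  have hmeas := measurable_sentSymbol (code := code) hY
  rw [Measure.map_apply ((measurable_sentPast hY k).prodMk (hmeas k))
    (measurableSet_singleton _), ← Set.singleton_prod_singleton, Measure.prod_prod,
    Measure.pi_singleton]
  set w' : ℕ → 𝒴 := fun i => if h : i < k then w ⟨i, h⟩ else v with hw'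
  have hset : (fun ω => (sentPast code Y k ω, sentSymbol code Y k ω)) ⁻¹'
      ({w} ×ˢ {v}) = {ω | ∀ i < k + 1, sentSymbol code Y i ω = w' i} := by
    ext ω
    rw [Set.mem_ofPred_eq, Nat.forall_lt_succ_right]
    simp only [Set.mem_preimage, Set.mem_prod, Set.mem_singleton_iff, hw', lt_irrefl,
      dite_false, funext_iff, Fin.forall_iff, sentPast]
    refine and_congr_left fun _ => forall₂_congr fun i hi => ?_
    rw [dif_pos hi]
  rw [hset, measure_forall_sentSymbol_eq hY hindep hlaw hpos, Finset.prod_range_succ,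
    Finset.prod_range]
  simp [hw']

lemma map_sentSymbol (hY : ∀ t, 1 ≤ t → Measurable (Y t))
    (hindep : iIndepFun (fun t => Y (t + 1)) μ) (hlaw : ∀ t, 1 ≤ t → μ.map (Y t) = ν)
    (hpos : ∀ y, ν {y} ≠ 0 → 0 < (code y).length) (k : ℕ) :
    μ.map (sentSymbol code Y k) = ν := by
  have hmeas := measurable_sentSymbol (code := code) hY
  have h := congrArg (Measure.map Prod.snd) (map_sentSymbol_prod hY hindep hlaw hpos k)
  rwa [Measure.map_map measurable_snd
    ((measurable_sentPast hY k).prodMk (hmeas k)), Measure.map_snd_prod,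
    measure_univ, one_smul] at h

variable [IsProbabilityMeasure μ]

lemma integral_past_mul_sentSymbol (hY : ∀ t, 1 ≤ t → Measurable (Y t))
    (hindep : iIndepFun (fun t => Y (t + 1)) μ) (hlaw : ∀ t, 1 ≤ t → μ.map (Y t) = ν)
    (hpos : ∀ y, ν {y} ≠ 0 → 0 < (code y).length) (k : ℕ) (F : (Fin k → 𝒴) → ℝ) (φ : 𝒴 → ℝ) :
    ∫ ω, F (sentPast code Y k ω) * φ (sentSymbol code Y k ω) ∂μ =
      (∫ ω, F (sentPast code Y k ω) ∂μ) * ∫ y, φ y ∂ν := by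
  have hmeas := measurable_sentSymbol (code := code) hY
  have hpast := measurable_sentPast (code := code) hY k
  have hjoint := map_sentSymbol_prod hY hindep hlaw hpos k
  have hfst : μ.map (sentPast code Y k) =
      Measure.pi fun _ : Fin k => ν := by
    have h := congrArg (Measure.map Prod.fst) hjoint
    rwa [Measure.map_map measurable_fst (hpast.prodMk (hmeas k)), Measure.map_fst_prod,
      measure_univ, one_smul] at h
  have hind : IndepFun (sentPast code Y k)
      (sentSymbol code Y k) μ := by
    rw [indepFun_iff_map_prod_eq_prod_map_map hpast.aemeasurable (hmeas k).aemeasurable, hjoint,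
      hfst, map_sentSymbol hY hindep hlaw hpos]
  have hφ : ∫ ω, φ (sentSymbol code Y k ω) ∂μ = ∫ y, φ y ∂ν := by
    rw [← map_sentSymbol hY hindep hlaw hpos k, integral_map (hmeas k).aemeasurable
      (measurable_of_finite φ).aestronglyMeasurable]
  rw [← hφ]
  exact (hind.comp (measurable_of_finite F) (measurable_of_finite φ)).integral_fun_mul_eq_mul_integral
    ((measurable_of_finite F).comp hpast).aestronglyMeasurable
    ((measurable_of_finite φ).comp (hmeas k)).aestronglyMeasurable

/-- Law of large numbers for the sent symbols with weights depending on the past. -/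
lemma ae_tendsto_weighted_average (hY : ∀ t, 1 ≤ t → Measurable (Y t))
    (hindep : iIndepFun (fun t => Y (t + 1)) μ) (hlaw : ∀ t, 1 ≤ t → μ.map (Y t) = ν)
    (hpos : ∀ y, ν {y} ≠ 0 → 0 < (code y).length) (h : ∀ k, (Fin k → 𝒴) → ℝ) {C : ℝ}
    (hC : ∀ k, ∫ ω, h k (sentPast code Y k ω) ^ 2 ∂μ ≤ C) (φ : 𝒴 → ℝ) :
    ∀ᵐ ω ∂μ, Tendsto (fun n : ℕ => (∑ k ∈ Finset.range n, h k (sentPast code Y k ω) *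
      (φ (sentSymbol code Y k ω) - ∫ y, φ y ∂ν)) / n) atTop (𝓝 0) := by
  have hmeas := measurable_sentSymbol (code := code) hY
  have hpast := measurable_sentPast (code := code) hY
  refine ae_tendsto_average_of_orthogonal (C := C * ∫ y, (φ y - ∫ y, φ y ∂ν) ^ 2 ∂ν)
    (fun k => ?_) (fun k => ?_) fun j k hjk => ?_
  · exact memLp_comp_of_finite ((hpast k).prodMk (hmeas k))
      fun q : (Fin k → 𝒴) × 𝒴 => h k q.1 * (φ q.2 - ∫ y, φ y ∂ν)
  · simp only [mul_pow]
    rw [integral_past_mul_sentSymbol hY hindep hlaw hpos k (fun p => h k p ^ 2)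
      fun y => (φ y - ∫ y, φ y ∂ν) ^ 2]
    exact mul_le_mul_of_nonneg_right (hC k) (integral_nonneg fun y => sq_nonneg _)
  -- For j < k, the j-th term and the k-th weight are functions of the past of k; the remaining
  -- factor is centred.
  · have := integral_past_mul_sentSymbol hY hindep hlaw hpos k
      (fun p => h j (fun i => p ⟨i, i.2.trans hjk⟩) * (φ (p ⟨j, hjk⟩) - ∫ y, φ y ∂ν) * h k p)
      fun y => φ y - ∫ y, φ y ∂ν
    rw [integral_sub Integrable.of_finite (integrable_const _), integral_const, probReal_univ,
      one_smul, sub_self, mul_zero] at this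
    simp only [mul_assoc] at this ⊢
    exact this

end SentSymbols

/-! ### The average age of a general memoryless source -/

section MemorylessSource

/-- This predictability of the age lets it serve as a weight in `ae_tendsto_weighted_average`. -/
lemma exists_ageAtPickup_eq {𝒴 Ω : Type*} (isSource : 𝒴 → Prop) (code : 𝒴 → List Bool)
    (Y : ℕ → Ω → 𝒴) (k : ℕ) :
    ∃ h : (Fin k → 𝒴) → ℝ, ∀ ω, ageAtPickup (fun t => code (Y t ω)) (fun t => isSource (Y t ω)) k =
      h (sentPast code Y k ω) := by
  classical
  induction k with
  | zero => exact ⟨fun _ => 1, fun ω => ageAtPickup_zero _ _⟩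
  | succ k ih =>
    obtain ⟨h, hh⟩ := ih
    refine ⟨fun w => (code (w (Fin.last k))).length +
      if isSource (w (Fin.last k)) then 0 else h (Fin.init w), fun ω => ?_⟩
    rw [ageAtPickup_succ, hh]
    rfl

variable {𝒴 : Type*} [Finite 𝒴] [MeasurableSpace 𝒴] [MeasurableSingletonClass 𝒴]
  {Ω : Type*} [MeasurableSpace Ω] {μ : Measure Ω} [IsProbabilityMeasure μ]
  {ν : Measure 𝒴} [IsProbabilityMeasure ν]
  {code : 𝒴 → List Bool} {Y : ℕ → Ω → 𝒴} (isSource : 𝒴 → Prop)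

open Classical in
/-- The second moment of the age at the pickups is bounded. -/
lemma exists_integral_sq_ageAtPickup_le (hY : ∀ t, 1 ≤ t → Measurable (Y t))
    (hindep : iIndepFun (fun t => Y (t + 1)) μ) (hlaw : ∀ t, 1 ≤ t → μ.map (Y t) = ν)
    (hpos : ∀ y, ν {y} ≠ 0 → 0 < (code y).length)
    (hp : 0 < ∫ y, (if isSource y then (1 : ℝ) else 0) ∂ν) :
    ∃ C, ∀ k, ∫ ω, ageAtPickup (fun t => code (Y t ω)) (fun t => isSource (Y t ω)) k ^ 2 ∂μ ≤ C := by
  obtain ⟨M, hM⟩ := (Set.finite_range fun y => (code y).length).bddAbove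
  set p := ∫ y, (if isSource y then (1 : ℝ) else 0) ∂ν with hpdef
  set D : ℕ → Ω → ℝ := fun k ω =>
    ageAtPickup (fun t => code (Y t ω)) (fun t => isSource (Y t ω)) k with hD
  -- From (l + d)² ≤ (1 + 2/p) l² + (1 + p/2) d², with l ≤ M.
  set K : ℝ := (1 + 2 / p) * (M : ℝ) ^ 2 with hK
  have hK0 : 0 ≤ K := by positivity
  -- As (1 + p/2)(1 - p) ≤ 1 - p/2, the second moments satisfy v_{k+1} ≤ K + (1 - p/2) v_k, with
  -- fixed point 2K/p; the extra 1 covers the initial age.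
  refine ⟨1 + 2 * K / p, fun k => ?_⟩
  change ∫ ω, D k ω ^ 2 ∂μ ≤ _
  induction k with
  | zero =>
    simp only [hD, ageAtPickup_zero, one_pow, integral_const, probReal_univ, one_smul]
    have : 0 ≤ 2 * K / p := by positivity
    linarith
  | succ k ih =>
    obtain ⟨h, hh⟩ := exists_ageAtPickup_eq isSource code Y k
    obtain ⟨h', hh'⟩ := exists_ageAtPickup_eq isSource code Y (k + 1)
    have hstep : ∀ ω, D (k + 1) ω ^ 2 ≤ K + (1 + p / 2) * (h (sentPast code Y k ω) ^ 2 *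
        (1 - if isSource (sentSymbol code Y k ω) then (1 : ℝ) else 0)) := by
      intro ω
      have hl : ((code (sentSymbol code Y k ω)).length : ℝ) ≤ M := by
        exact_mod_cast hM ⟨_, rfl⟩
      have hl2 : ((code (sentSymbol code Y k ω)).length : ℝ) ^ 2 ≤ (M : ℝ) ^ 2 := by gcongr
      have hKl : (1 + 2 / p) * ((code (sentSymbol code Y k ω)).length : ℝ) ^ 2 ≤ K := by
        rw [hK]
        gcongr
      have hval : D (k + 1) ω = (code (sentSymbol code Y k ω)).length +
          if isSource (sentSymbol code Y k ω) then 0 else h (sentPast code Y k ω) := by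
        rw [← hh ω]
        exact ageAtPickup_succ _ _ k
      rw [hval]
      set l := ((code (sentSymbol code Y k ω)).length : ℝ)
      split_ifs
      · have : 0 ≤ 2 / p * l ^ 2 := by positivity
        nlinarith
      · set d := h (sentPast code Y k ω)
        have hsq : (l + d) ^ 2 + 2 / p * (l - p / 2 * d) ^ 2 =
            (1 + 2 / p) * l ^ 2 + (1 + p / 2) * d ^ 2 := by
          field_simp
          ring
        have : 0 ≤ 2 / p * (l - p / 2 * d) ^ 2 := by positivity
        linarith
    have hint : Integrable (fun ω => h (sentPast code Y k ω) ^ 2 *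
        (1 - if isSource (sentSymbol code Y k ω) then (1 : ℝ) else 0)) μ :=
      memLp_one_iff_integrable.1 (memLp_comp_of_finite
        ((measurable_sentPast hY k).prodMk (measurable_sentSymbol hY k))
        fun q : (Fin k → 𝒴) × 𝒴 => h q.1 ^ 2 * (1 - if isSource q.2 then (1 : ℝ) else 0))
    have hint' : Integrable (fun ω => D (k + 1) ω ^ 2) μ := by
      simp only [hD, hh']
      exact (memLp_comp_of_finite (measurable_sentPast hY (k + 1)) h').integrable_sq
    have hfact := integral_past_mul_sentSymbol hY hindep hlaw hpos k (fun w => h w ^ 2)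
      fun y => 1 - if isSource y then (1 : ℝ) else 0
    rw [integral_sub (integrable_const _) Integrable.of_finite, integral_const, probReal_univ,
      one_smul, ← hpdef] at hfact
    have hv : ∫ ω, h (sentPast code Y k ω) ^ 2 ∂μ = ∫ ω, D k ω ^ 2 ∂μ := by
      simp only [hD, hh]
    have hv0 : 0 ≤ ∫ ω, D k ω ^ 2 ∂μ := integral_nonneg fun ω => sq_nonneg _
    have hle := integral_mono hint' ((integrable_const K).add (hint.const_mul (1 + p / 2))) hstep
    rw [integral_add' (integrable_const K) (hint.const_mul _), integral_const, probReal_univ,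
      one_smul, integral_const_mul, hfact, hv] at hle
    refine hle.trans ?_
    have h1 : K + (1 - p / 2) * (1 + 2 * K / p) = 1 + 2 * K / p - p / 2 := by
      field_simp
      ring
    have hp1 : p ≤ 1 := by
      have := integral_mono (μ := ν) (f := fun y => if isSource y then (1 : ℝ) else 0)
        (g := fun _ => 1) Integrable.of_finite (integrable_const _)
        fun y => by dsimp only; split_ifs <;> norm_num
      simpa using this
    have h2 : (1 - p / 2) * ∫ ω, D k ω ^ 2 ∂μ ≤ (1 - p / 2) * (1 + 2 * K / p) :=
      mul_le_mul_of_nonneg_left ih (by linarith)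
    nlinarith [mul_nonneg (sq_nonneg p) hv0]

open Classical in
/-- The average age for an arbitrary memoryless source of codewords, some of which count as
updates. -/
theorem ae_averageAge_eq (hY : ∀ t, 1 ≤ t → Measurable (Y t))
    (hindep : iIndepFun (fun t => Y (t + 1)) μ) (hlaw : ∀ t, 1 ≤ t → μ.map (Y t) = ν)
    (hpos : ∀ y, ν {y} ≠ 0 → 0 < (code y).length)
    (hp : 0 < ∫ y, (if isSource y then (1 : ℝ) else 0) ∂ν)
    (hm : 0 < ∫ y, ((code y).length : ℝ) ∂ν) :
    ∀ᵐ ω ∂μ, averageAge (fun t => code (Y t ω)) (fun t => isSource (Y t ω)) =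
      (((∫ y, ((code y).length : ℝ) ∂ν) / (∫ y, (if isSource y then (1 : ℝ) else 0) ∂ν)
        + (∫ y, ((code y).length : ℝ) ^ 2 ∂ν) / (2 * ∫ y, ((code y).length : ℝ) ∂ν)
        - 1 / 2 : ℝ) : EReal) := by
  set m₁ := ∫ y, ((code y).length : ℝ) ∂ν with hm₁
  set m₂ := ∫ y, ((code y).length : ℝ) ^ 2 ∂ν with hm₂
  set p := ∫ y, (if isSource y then (1 : ℝ) else 0) ∂ν with hpdef
  obtain ⟨M, hM⟩ := (Set.finite_range fun y => (code y).length).bddAbove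
  obtain ⟨C, hC⟩ := exists_integral_sq_ageAtPickup_le isSource hY hindep hlaw hpos hp
  choose h hh using exists_ageAtPickup_eq isSource code Y
  have hC' : ∀ k, ∫ ω, h k (sentPast code Y k ω) ^ 2 ∂μ ≤ C := fun k => by
    simpa only [← hh] using hC k
  have hone : ∀ k, ∫ ω, (fun (k : ℕ) (_ : Fin k → 𝒴) => (1 : ℝ)) k (sentPast code Y k ω) ^ 2 ∂μ
      ≤ 1 := fun k => by simp
  have hsent : ∀ᵐ ω ∂μ, ∀ k, 0 < (code (sentSymbol code Y k ω)).length := by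
    refine ae_all_iff.2 fun k => ?_
    have hν : ∀ᵐ y ∂μ.map (sentSymbol code Y k), 0 < (code y).length := by
      rw [map_sentSymbol hY hindep hlaw hpos, ae_iff_of_countable]
      exact hpos
    exact ae_of_ae_map (measurable_sentSymbol hY k).aemeasurable hν
  -- This removes the boundary term D_n from the summed recursion.
  have hDn : ∀ᵐ ω ∂μ, Tendsto (fun n : ℕ => h n (sentPast code Y n ω) / n) atTop (𝓝 0) := by
    refine ae_tendsto_zero_of_integral_sq_le (fun n => ?_)
      ((Real.summable_one_div_nat_pow.2 one_lt_two).mul_left C) fun n => ?_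
    · exact memLp_comp_of_finite (measurable_sentPast hY n) fun w => h n w / n
    · simp only [div_pow]
      rw [integral_div, mul_one_div]
      exact div_le_div_of_nonneg_right (hC' n) (sq_nonneg _)
  filter_upwards [hsent, hDn,
    ae_tendsto_weighted_average hY hindep hlaw hpos (fun _ _ => 1) hone
      fun y => ((code y).length : ℝ),
    ae_tendsto_weighted_average hY hindep hlaw hpos (fun _ _ => 1) hone
      fun y => ((code y).length : ℝ) ^ 2,
    ae_tendsto_weighted_average hY hindep hlaw hpos h hC'
      fun y => if isSource y then (1 : ℝ) else 0,
    ae_tendsto_weighted_average hY hindep hlaw hpos h hC' fun y => ((code y).length : ℝ)]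
    with ω hposω hDω h₁ h₂ hs hb
  simp only [← hm₁, ← hm₂, ← hpdef, ← hh, one_mul, ← sentLength_eq] at h₁ h₂ hs hb hDω hposω
  set c := fun t => code (Y t ω)
  set src := fun t => isSource (Y t ω)
  have hsum : ∀ (f g : ℕ → ℝ) (a l : ℝ),
      Tendsto (fun n : ℕ => (∑ k ∈ Finset.range n, f k * (g k - a)) / n) atTop (𝓝 0) →
      Tendsto (fun n : ℕ => (∑ k ∈ Finset.range n, f k) / n) atTop (𝓝 l) →
      Tendsto (fun n : ℕ => (∑ k ∈ Finset.range n, f k * g k) / n) atTop (𝓝 (l * a)) := by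
    intro f g a l h0 hl
    refine (zero_add (l * a) ▸ h0.add (hl.mul_const a)).congr fun n => ?_
    simp only [mul_sub, Finset.sum_sub_distrib, ← Finset.sum_mul]
    ring
  have hconst : Tendsto (fun n : ℕ => (∑ k ∈ Finset.range n, (1 : ℝ)) / n) atTop (𝓝 1) := by
    refine tendsto_const_nhds.congr' ?_
    filter_upwards [eventually_gt_atTop 0] with n hn
    have hn' : (n : ℝ) ≠ 0 := by exact_mod_cast hn.ne'
    simp [hn']
  have H₁ := hsum (fun _ => 1) (fun k => (sentLength c k : ℝ)) m₁ 1
    (by simpa only [one_mul] using h₁) hconst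
  have H₂ := hsum (fun _ => 1) (fun k => (sentLength c k : ℝ) ^ 2) m₂ 1
    (by simpa only [one_mul] using h₂) hconst
  simp only [one_mul] at H₁ H₂
  -- The summed recursion gives the average of s_k D_k the limit m₁; by the weighted law it differs
  -- from p times the average of D_k by a null sequence.
  have hage : Tendsto (fun n : ℕ => (∑ k ∈ Finset.range n, ageAtPickup c src k) / n) atTop
      (𝓝 (m₁ / p)) := by
    have hlim := ((H₁.sub hDω).add tendsto_one_div_atTop_nhds_zero_nat).sub hs
    have hlim' := hlim.div_const p
    rw [sub_zero, add_zero, sub_zero] at hlim'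
    refine hlim'.congr fun n => ?_
    have hrec := sum_ite_ageAtPickup (c := c) src n
    have hexp : ∑ k ∈ Finset.range n, ageAtPickup c src k *
        ((if isSource (sentSymbol code Y k ω) then (1 : ℝ) else 0) - p) =
        ∑ k ∈ Finset.range n, (if src (pickupTime c k) then (1 : ℝ) else 0) * ageAtPickup c src k
          - (∑ k ∈ Finset.range n, ageAtPickup c src k) * p := by
      rw [Finset.sum_mul, ← Finset.sum_sub_distrib]
      refine Finset.sum_congr rfl fun k _ => ?_
      change _ * ((if src (pickupTime c k) then (1 : ℝ) else 0) - p) = _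
      ring
    rw [hexp, hrec]
    field_simp
    ring
  have H := averageAge_eq_of_tendsto src hposω (fun k => hM ⟨_, rfl⟩) hm H₁ H₂
    (hsum _ _ _ _ hb hage)
  rw [H]
  congr 1
  field_simp
  ring

end MemorylessSource

/-! ### Prefix-free codes and the law of the transmitted symbol -/

section Codes

lemma expect_eq_integral {α : Type*} [Fintype α] [MeasurableSpace α] [MeasurableSingletonClass α]
    (P : PMF α) (f : α → ℝ) : expect P f = ∫ a, f a ∂P.toMeasure := by
  rw [PMF.integral_eq_sum]
  rfl

/-- The transmitted codewords of a prefix-free code are not empty, unless all of them are. -/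
lemma length_pos_of_isPrefixFreeOn {α : Type*} [Fintype α] {P : PMF α} {e : α → List Bool}
    (he : IsPrefixFreeOn e P.support) (hpos : 0 < expect P fun a => ((e a).length : ℝ)) {a : α}
    (ha : P a ≠ 0) : 0 < (e a).length := by
  by_contra h
  have hnil : e a = [] := List.length_eq_zero_iff.1 (Nat.eq_zero_of_not_pos h)
  refine hpos.ne' (Finset.sum_eq_zero fun b _ => ?_)
  by_cases hb : P b = 0
  · simp [hb]
  -- The empty word is a prefix of every codeword, so no second symbol can have positive mass.
  · have hab : a = b := by
      by_contra hab
      exact he a ha b hb hab (hnil ▸ List.nil_prefix)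
    simp [← hab, hnil]

/-- The symbol transmitted for the source symbol `y.1` and the coin toss `y.2`. -/
def transmitted {𝒳 : Type*} (y : 𝒳 × Bool) : Option 𝒳 := if y.2 = true then some y.1 else none

lemma map_transmitted {𝒳 : Type*} [Fintype 𝒳] [MeasurableSpace 𝒳] [MeasurableSingletonClass 𝒳]
    {P : PMF 𝒳} {θ : 𝒳 → Set.Icc (0 : ℝ) 1} {ν : Measure (𝒳 × Bool)} [IsProbabilityMeasure ν]
    (hν : ∀ x, ν {(x, true)} = P x * ENNReal.ofReal (θ x)) (o : Option 𝒳) :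
    ν (transmitted ⁻¹' {o}) = sentPMF P θ o := by
  have hsome : ∀ x : 𝒳, transmitted ⁻¹' {some x} = {(x, true)} := by
    intro x
    ext ⟨x', b⟩
    cases b <;> simp [transmitted]
  cases o with
  | some x =>
    rw [hsome, hν]
    rfl
  | none =>
    have hcompl : (transmitted ⁻¹' {none} : Set (𝒳 × Bool)) =
        (⋃ x ∈ (Finset.univ : Finset 𝒳), {(x, true)})ᶜ := by
      ext ⟨x, b⟩
      cases b <;> simp [transmitted]
    rw [hcompl, prob_compl_eq_one_sub (Set.toFinite _).measurableSet,
      measure_biUnion_finset (fun x _ x' _ hx => by simpa using hx)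
        fun x _ => measurableSet_singleton _]
    simp only [hν]
    rfl

lemma integral_transmitted {𝒳 : Type*} [Fintype 𝒳] [MeasurableSpace 𝒳]
    [MeasurableSingletonClass 𝒳] {P : PMF 𝒳} {θ : 𝒳 → Set.Icc (0 : ℝ) 1}
    {ν : Measure (𝒳 × Bool)} [IsProbabilityMeasure ν]
    (hν : ∀ x, ν {(x, true)} = P x * ENNReal.ofReal (θ x)) (f : Option 𝒳 → ℝ) :
    ∫ y, f (transmitted y) ∂ν = expect (sentPMF P θ) f := by
  let _ : MeasurableSpace (Option 𝒳) := ⊤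
  have hmap : ν.map transmitted = (sentPMF P θ).toMeasure := by
    refine Measure.ext_of_singleton fun o => ?_
    rw [Measure.map_apply (measurable_of_finite _) (measurableSet_singleton _),
      map_transmitted hν, PMF.toMeasure_apply_singleton _ _ (measurableSet_singleton _)]
  rw [expect_eq_integral, ← hmap, integral_map (measurable_of_finite _).aemeasurable
    (measurable_of_finite f).aestronglyMeasurable]

lemma expect_sentPMF_isSome {𝒳 : Type*} [Fintype 𝒳] (P : PMF 𝒳) (θ : 𝒳 → Set.Icc (0 : ℝ) 1) :
    expect (sentPMF P θ) (fun o => if o.isSome = true then 1 else 0) =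
      expect P fun x => (θ x : ℝ) := by
  rw [expect, Fintype.sum_option, expect]
  simp only [Option.isSome_none, Option.isSome_some, if_true, mul_one, Bool.false_eq_true,
    if_false, mul_zero, zero_add]
  refine Finset.sum_congr rfl fun x _ => ?_
  change (P x * ENNReal.ofReal (θ x)).toReal = _
  rw [ENNReal.toReal_mul, ENNReal.toReal_ofReal (θ x).2.1]

end Codes

/-! ### The two update schemes -/

section AverageAge

variable {𝒳 : Type*} [Fintype 𝒳] [MeasurableSpace 𝒳] [MeasurableSingletonClass 𝒳]
  {Ω : Type*} [MeasurableSpace Ω] {μ : Measure Ω} [IsProbabilityMeasure μ] {P : PMF 𝒳}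

theorem ae_memorylessAverageAge_eq {X : ℕ → Ω → 𝒳} (hX : ∀ t, 1 ≤ t → Measurable (X t))
    (hindep : iIndepFun (fun t : ℕ => X (t + 1)) μ)
    (hlaw : ∀ t, 1 ≤ t → ∀ x, μ {ω | X t ω = x} = P x) {e : 𝒳 → List Bool}
    (he : IsPrefixFreeOn e P.support) (hpos : 0 < expect P fun x => ((e x).length : ℝ)) :
    ∀ᵐ ω ∂μ, memorylessAverageAge e (fun t => X t ω) =
      ((expect P (fun x => ((e x).length : ℝ)) + expect P (fun x => ((e x).length : ℝ) ^ 2)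
        / (2 * expect P (fun x => ((e x).length : ℝ))) - 1 / 2 : ℝ) : EReal) := by
  have hmap : ∀ t, 1 ≤ t → μ.map (X t) = P.toMeasure := fun t ht => by
    refine Measure.ext_of_singleton fun x => ?_
    rw [Measure.map_apply (hX t ht) (measurableSet_singleton _),
      PMF.toMeasure_apply_singleton _ _ (measurableSet_singleton _)]
    exact hlaw t ht x
  have h := ae_averageAge_eq (code := e) (fun _ => True) hX hindep hmap
    (fun y hy => length_pos_of_isPrefixFreeOn he hpos <| by
      rwa [PMF.toMeasure_apply_singleton _ _ (measurableSet_singleton _)] at hy)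
    (by simp) (by rwa [← expect_eq_integral])
  simp only [if_true, integral_const, probReal_univ, one_smul, div_one, ← expect_eq_integral] at h
  exact h

theorem ae_randomizedAverageAge_eq {X : ℕ → Ω → 𝒳} {B : ℕ → Ω → Bool}
    {θ : 𝒳 → Set.Icc (0 : ℝ) 1} (hX : ∀ t, 1 ≤ t → Measurable (X t))
    (hB : ∀ t, 1 ≤ t → Measurable (B t))
    (hindep : iIndepFun (fun (t : ℕ) ω => (X (t + 1) ω, B (t + 1) ω)) μ)
    (hlaw : ∀ t, 1 ≤ t → ∀ x, μ {ω | X t ω = x} = P x)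
    (hlawB : ∀ t, 1 ≤ t → ∀ x,
      μ {ω | X t ω = x ∧ B t ω = true} = P x * ENNReal.ofReal (θ x))
    {e : Option 𝒳 → List Bool} (he : IsPrefixFreeOn e (sentPMF P θ).support)
    (hθ : 0 < expect P fun x => (θ x : ℝ))
    (hpos : 0 < expect (sentPMF P θ) fun o => ((e o).length : ℝ)) :
    ∀ᵐ ω ∂μ, randomizedAverageAge e (fun t => X t ω) (fun t => B t ω) =
      ((expect (sentPMF P θ) (fun o => ((e o).length : ℝ)) / expect P (fun x => (θ x : ℝ))
        + expect (sentPMF P θ) (fun o => ((e o).length : ℝ) ^ 2)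
          / (2 * expect (sentPMF P θ) (fun o => ((e o).length : ℝ))) - 1 / 2 : ℝ) : EReal) := by
  set Y : ℕ → Ω → 𝒳 × Bool := fun t ω => (X t ω, B t ω) with hYdef
  have hY : ∀ t, 1 ≤ t → Measurable (Y t) := fun t ht => (hX t ht).prodMk (hB t ht)
  have htrue : ∀ t, 1 ≤ t → ∀ x, μ.map (Y t) {(x, true)} = P x * ENNReal.ofReal (θ x) := by
    intro t ht x
    rw [Measure.map_apply (hY t ht) (measurableSet_singleton _), ← hlawB t ht x]
    congr 1
    ext ω
    simp [hYdef]
  -- Subtracting from the marginal of X gives the remaining masses, so all pairs share one law.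
  have hfalse : ∀ t, 1 ≤ t → ∀ x,
      μ.map (Y t) {(x, false)} = P x - P x * ENNReal.ofReal (θ x) := by
    intro t ht x
    have hmeas : MeasurableSet {ω | X t ω = x ∧ B t ω = true} :=
      (hX t ht (measurableSet_singleton x)).inter (hB t ht (measurableSet_singleton true))
    have hsub : {ω | X t ω = x ∧ B t ω = true} ⊆ {ω | X t ω = x} := fun ω hω => hω.1
    rw [Measure.map_apply (hY t ht) (measurableSet_singleton _), ← hlawB t ht x, ← hlaw t ht x,
      ← measure_sdiff hsub hmeas.nullMeasurableSet (measure_ne_top _ _)]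
    congr 1
    ext ω
    simp +contextual [hYdef]
  set ν := μ.map (Y 1) with hν
  have : IsProbabilityMeasure ν := Measure.isProbabilityMeasure_map (hY 1 le_rfl).aemeasurable
  have hmap : ∀ t, 1 ≤ t → μ.map (Y t) = ν := fun t ht => by
    refine Measure.ext_of_singleton fun y => ?_
    obtain ⟨x, b⟩ := y
    cases b
    · rw [hfalse t ht, hν, hfalse 1 le_rfl]
    · rw [htrue t ht, hν, htrue 1 le_rfl]
  have hint := integral_transmitted (htrue 1 le_rfl)
  have hp : ∫ y, (if (transmitted y).isSome = true then (1 : ℝ) else 0) ∂ν =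
      expect P fun x => (θ x : ℝ) := by
    rw [hint fun o => if o.isSome = true then (1 : ℝ) else 0, expect_sentPMF_isSome]
  have hm := hint fun o => ((e o).length : ℝ)
  have hm2 := hint fun o => ((e o).length : ℝ) ^ 2
  -- The pairs (X, B) act as the memoryless source; a pair of positive mass yields a transmitted
  -- symbol of positive mass.
  have h := ae_averageAge_eq (code := fun y => e (transmitted y))
    (fun y => (transmitted y).isSome = true) hY hindep hmap
    (fun y hy => length_pos_of_isPrefixFreeOn he hpos <| by
      rw [← map_transmitted (htrue 1 le_rfl)]
      have hsub : {y} ⊆ transmitted ⁻¹' {transmitted y} := by simp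
      exact fun h0 => hy (measure_mono_null hsub h0))
    (by convert hθ; convert hp) (by rwa [hm])
  have hp' : ∫ y, (@ite ℝ ((transmitted y).isSome = true) (Classical.propDecidable _) 1 0) ∂ν =
      expect P fun x => (θ x : ℝ) := by convert hp
  rw [hm, hm2, hp'] at h
  have hcode : ∀ y : 𝒳 × Bool, e (transmitted y) = if y.2 = true then e (some y.1) else e none :=
    fun y => apply_ite e _ _ _
  have hsrc : ∀ y : 𝒳 × Bool, ((transmitted y).isSome = true) = (y.2 = true) := by
    rintro ⟨x, b⟩
    cases b <;> simp [transmitted]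
  simp only [hcode, hsrc] at h
  exact h

end AverageAge

end AgeOfInformation

end

theorem mainTheorem3
    {𝒳 : Type*} [Fintype 𝒳] [MeasurableSpace 𝒳] [MeasurableSingletonClass 𝒳]
    {Ω : Type*} [MeasurableSpace Ω] (μ : Measure Ω) [IsProbabilityMeasure μ]
    (P : PMF 𝒳) :
    -- the deterministic scheme
    (∀ (X : ℕ → Ω → 𝒳),
      (∀ t, 1 ≤ t → Measurable (X t)) →
      iIndepFun (fun t : ℕ => X (t + 1)) μ →
      (∀ t, 1 ≤ t → ∀ x, μ {ω | X t ω = x} = P x) →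
      ∀ (e : 𝒳 → List Bool), AgeOfInformation.IsPrefixFreeOn e Set.univ →
      0 < AgeOfInformation.expect P (fun x => ((e x).length : ℝ)) →
      ∀ᵐ ω ∂μ,
        AgeOfInformation.memorylessAverageAge e (fun t => X t ω) =
          ((AgeOfInformation.expect P (fun x => ((e x).length : ℝ))
            + AgeOfInformation.expect P (fun x => ((e x).length : ℝ) ^ 2)
              / (2 * AgeOfInformation.expect P (fun x => ((e x).length : ℝ)))
            - 1 / 2 : ℝ) : EReal)) ∧
    -- the randomized scheme
    (∀ (X : ℕ → Ω → 𝒳) (B : ℕ → Ω → Bool) (θ : 𝒳 → Set.Icc (0 : ℝ) 1),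
      (∀ t, 1 ≤ t → Measurable (X t)) →
      (∀ t, 1 ≤ t → Measurable (B t)) →
      iIndepFun (fun (t : ℕ) ω => (X (t + 1) ω, B (t + 1) ω)) μ →
      (∀ t, 1 ≤ t → ∀ x, μ {ω | X t ω = x} = P x) →
      (∀ t, 1 ≤ t → ∀ x, μ {ω | X t ω = x ∧ B t ω = true} = P x * ENNReal.ofReal (θ x)) →
      ∀ (e : Option 𝒳 → List Bool),
      AgeOfInformation.IsPrefixFreeOn e (AgeOfInformation.sentPMF P θ).support →
      0 < AgeOfInformation.expect P (fun x => (θ x : ℝ)) →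
      0 < AgeOfInformation.expect (AgeOfInformation.sentPMF P θ)
        (fun o => ((e o).length : ℝ)) →
      ∀ᵐ ω ∂μ,
        AgeOfInformation.randomizedAverageAge e (fun t => X t ω) (fun t => B t ω) =
          ((AgeOfInformation.expect (AgeOfInformation.sentPMF P θ)
                (fun o => ((e o).length : ℝ))
              / AgeOfInformation.expect P (fun x => (θ x : ℝ))
            + AgeOfInformation.expect (AgeOfInformation.sentPMF P θ)
                (fun o => ((e o).length : ℝ) ^ 2)
              / (2 * AgeOfInformation.expect (AgeOfInformation.sentPMF P θ)
                  (fun o => ((e o).length : ℝ)))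
            - 1 / 2 : ℝ) : EReal)) := by
  refine ⟨fun X hX hindep hlaw e he hpos => ?_, fun X B θ hX hB hindep hlaw hlawB e he hθ hpos => ?_⟩
  · exact AgeOfInformation.ae_memorylessAverageAge_eq hX hindep hlaw
      (fun a _ b _ => he a (Set.mem_univ a) b (Set.mem_univ b)) hpos
  · exact AgeOfInformation.ae_randomizedAverageAge_eq hX hB hindep hlaw hlawB he hθ hpos
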